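/- Let $n\ge 2$ be an integer and $\mu>1$ a real number. Define masks by $a^{(n,0)}_0=a^{(n,0)}_1=\tfrac12$, $a^{(n,0)}_\alpha=0$ otherwise, and, for $m\ge 1$ and $0\le\alpha\le n+1$, $$a^{(n,m)}_\alpha=\frac{1}{2^{\,n+1+m^{-\mu}}}\left[\binom{n+1}{\alpha}+4\,\bigl(2^{m^{-\mu}}-1\bigr)\binom{n-1}{\alpha-1}\right],$$ with $a^{(n,m)}_\alpha=0$ otherwise (and $\binom{n-1}{-1}=\binom{n-1}{n}=0$). For $m\ge 0$ let $\varphi^{(n,m)}$ be the limit in $L_2(\mathbb R)$, as $k\to\infty$, of the cascade algorithm $$h^{m}_0=2^m\chi_{[0,2^{-m})},\qquad h^m_{k+1}=\sum_{\alpha=0}^{n+1}a^{(n,m)}_\alpha\,h^{m+1}_k\bigl(\cdot-2^{-(m+1)}\alpha\bigr),\qquad k,m\ge 0.$$ These limits exist and are integrable; let $\widehat\varphi^{(n,m)}(\omega)=\int_{\mathbb R}\varphi^{(n,m)}(x)\,e^{-i\omega x}\,dx$. Then the following Strang--Fix conditions hold. (i) For every $m>0$ and every $\alpha\in\mathbb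 Z\setminus\{0\}$, $\widehat\varphi^{(n,m)}$ has a zero of order exactly $n-1$ at $\omega=2^{m+1}\pi\alpha$. (ii) For every $\alpha\in\mathbb Z\setminus\{0\}$, $\widehat\varphi^{(n,0)}$ has a zero of order at least $1$ at $\omega=2\pi\alpha$; the zero is simple (of order exactly $1$) if $\alpha$ is odd, and of order exactly $n-1$ if $\alpha$ is even. -/

import Mathlib

namespace Ripplet

open MeasureTheory Filter Topology

/-- The entry `a^{(n,m)}_α` of the scaling mask of level `m`, with tension parameter `μ`.
The binomial coefficient `binom (n-1) (α-1)` is zero for `α = 0`. -/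
noncomputable def mask (n : ℕ) (μ : ℝ) (m α : ℕ) : ℝ :=
  if m = 0 then
    (if α = 0 ∨ α = 1 then 1 / 2 else 0)
  else
    1 / (2 : ℝ) ^ ((n : ℝ) + 1 + (m : ℝ) ^ (-μ)) *
      (((n + 1).choose α : ℝ) +
        4 * ((2 : ℝ) ^ ((m : ℝ) ^ (-μ)) - 1) *
          (if α = 0 then 0 else ((n - 1).choose (α - 1) : ℝ)))

/-- The starting function of the cascade algorithm at level `m`: the `2^m`-dilate
`2^m χ_{[0,1)}(2^m x)` of the characteristic function of the unit interval, of integral one. -/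
noncomputable def box (m : ℕ) : ℝ → ℝ :=
  (Set.Ico (0 : ℝ) (1 / 2 ^ m)).indicator (fun _ => (2 : ℝ) ^ m)

/-- The nonstationary cascade algorithm
`h^m_{k+1} = ∑_α a^{(n,m)}_α h^{m+1}_k (· - 2^{-(m+1)} α)`; `cascade n μ k m` is `h^m_k`. -/
noncomputable def cascade (n : ℕ) (μ : ℝ) : ℕ → ℕ → ℝ → ℝ
  | 0, m => box m
  | k + 1, m => fun x =>
      ∑ α ∈ Finset.range (n + 2),
        mask n μ m α * cascade n μ k (m + 1) (x - (α : ℝ) / 2 ^ (m + 1))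

/-- `f` is square integrable and is the strong `L²(ℝ)` limit of the cascade at level `m`. -/
def IsCascadeLimit (n : ℕ) (μ : ℝ) (m : ℕ) (f : ℝ → ℝ) : Prop :=
  MemLp f 2 volume ∧
    Tendsto (fun k : ℕ => eLpNorm (fun x => cascade n μ k m x - f x) 2 volume) atTop (𝓝 0)

open Classical in
/-- The nonstationary refinable function `φ^{(n,m)}` (a representative of its `L²` class):
the strong `L²` limit of the cascade algorithm. -/
noncomputable def phi (n : ℕ) (μ : ℝ) (m : ℕ) : ℝ → ℝ :=
  if h : ∃ f : ℝ → ℝ, IsCascadeLimit n μ m f then h.choose else 0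

/-- The Fourier transform `ω ↦ ∫ f(x) e^{-iωx} dx` (angular frequency, no prefactor). -/
noncomputable def hat (f : ℝ → ℝ) (ω : ℝ) : ℂ :=
  ∫ x : ℝ, (f x : ℂ) * Complex.exp (-(Complex.I * (ω : ℂ) * (x : ℂ)))

end Ripplet

namespace Ripplet

open MeasureTheory Filter Topology Polynomial

/-! Each symbol is $(1+X)/2$ times a cofactor with nonnegative coefficients summing to one. The
factor $(1+X)/2$ turns `box (m+1)` into `box m`, so every iterate at level `m` is `box m` convolved
with a discrete probability measure (`cascade_eq_average`). Passing from `k` to `k+1` adds one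
average over shifts of size $O(2^{-k})$, so the cascade converges geometrically in every $L^p$,
$1\le p<\infty$. The $L^1$ limit makes Fourier transforms converge pointwise.

On the Fourier side the symbol of level $j\ge1$ at $w=e^{-i\omega/2^{j+1}}$ is $((1+w)/2)^{n-1}$
times `tensionFactor`. The powers telescope, so for $m\ge1$ the transform off the origin is `boxHat`
of $\omega/2^m$ to the power $n-1$ times an infinite product (`hat_phi`). That product is entire and
has no real zero, because on the unit circle the tension factor is $w$ times a positive number. So
the zeros are those of `boxHat`, each simple, raised to the power $n-1$. Level 0 multiplies the
level 1 transform by $(1+e^{-i\omega/2})/2$, which has a simple zero at $2\pi\alpha$ for odd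
$\alpha$ and none for even $\alpha$. -/

/-- Translation by `s`, as a linear operator on functions. -/
noncomputable def shift (s : ℝ) : Module.End ℝ (ℝ → ℝ) :=
  LinearMap.funLeft ℝ ℝ (fun x => x - s)

@[simp] lemma shift_apply (s : ℝ) (f : ℝ → ℝ) (x : ℝ) : shift s f x = f (x - s) := rfl

lemma shift_pow (s : ℝ) (i : ℕ) : shift s ^ i = shift (i * s) := by
  induction i with
  | zero => ext f x; simp
  | succ i ih =>
    rw [pow_succ, ih]
    ext f x
    simp only [Module.End.mul_apply, shift_apply]
    congr 1
    push_cast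
    ring

lemma shift_commute (s t : ℝ) : Commute (shift s) (shift t) := by
  ext f x
  simp only [Module.End.mul_apply, shift_apply]
  congr 1
  ring

/-! ### Discrete convolutions and their $L^p$ bounds -/

/-- The convolution operator `f ↦ ∑ i, p_i f (· - i s)` with symbol `p` and step `s`. -/
noncomputable def subdiv (p : ℝ[X]) (s : ℝ) : Module.End ℝ (ℝ → ℝ) := aeval (shift s) p

lemma subdiv_eq_sum (p : ℝ[X]) (s : ℝ) (f : ℝ → ℝ) :
    subdiv p s f = ∑ i ∈ Finset.range (p.natDegree + 1), p.coeff i • shift (i * s) f := by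
  rw [subdiv, aeval_eq_sum_range]
  simp [LinearMap.sum_apply, shift_pow]

lemma subdiv_mul (p q : ℝ[X]) (s : ℝ) : subdiv (p * q) s = subdiv p s * subdiv q s := by
  simp [subdiv]

lemma commute_subdiv {T : Module.End ℝ (ℝ → ℝ)} {s : ℝ} (h : Commute T (shift s)) (p : ℝ[X]) :
    Commute T (subdiv p s) := by
  induction p using Polynomial.induction_on' with
  | add p q hp hq =>
    simpa [subdiv] using Commute.add_right hp hq
  | monomial i a =>
    rw [subdiv, aeval_monomial]
    exact Commute.mul_right (Algebra.commutes a T).symm (h.pow_right i)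

lemma aestronglyMeasurable_shift {f : ℝ → ℝ} (hf : AEStronglyMeasurable f volume) (s : ℝ) :
    AEStronglyMeasurable (shift s f) volume :=
  hf.comp_measurePreserving (measurePreserving_sub_right volume s)

lemma eLpNorm_shift {f : ℝ → ℝ} (hf : AEStronglyMeasurable f volume) (s : ℝ) (p : ENNReal) :
    eLpNorm (shift s f) p volume = eLpNorm f p volume :=
  eLpNorm_comp_measurePreserving hf (measurePreserving_sub_right volume s)

lemma memLp_shift {f : ℝ → ℝ} {p : ENNReal} (hf : MemLp f p volume) (s : ℝ) :
    MemLp (shift s f) p volume :=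
  hf.comp_measurePreserving (measurePreserving_sub_right volume s)

lemma memLp_subdiv {f : ℝ → ℝ} {p : ENNReal} (hf : MemLp f p volume) (q : ℝ[X]) (s : ℝ) :
    MemLp (subdiv q s f) p volume := by
  rw [subdiv_eq_sum]
  exact memLp_finsetSum' _ fun i _ => (memLp_shift hf _).const_smul _

/-- A symbol with nonnegative coefficients that sum to one. -/
def IsStochastic (q : ℝ[X]) : Prop := (∀ i, 0 ≤ q.coeff i) ∧ q.eval 1 = 1

lemma IsStochastic.sum_coeff {q : ℝ[X]} (hq : IsStochastic q) :
    ∑ i ∈ Finset.range (q.natDegree + 1), q.coeff i = 1 := by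
  simpa [eval_eq_sum_range] using hq.2

lemma sum_ofReal_mul_le {q : ℝ[X]} (hq : IsStochastic q) {a : ℕ → ENNReal} {b : ENNReal}
    (h : ∀ i ∈ Finset.range (q.natDegree + 1), a i ≤ b) :
    ∑ i ∈ Finset.range (q.natDegree + 1), ENNReal.ofReal (q.coeff i) * a i ≤ b := by
  calc _ ≤ ∑ i ∈ Finset.range (q.natDegree + 1), ENNReal.ofReal (q.coeff i) * b :=
        Finset.sum_le_sum fun i hi => by gcongr; exact h i hi
    _ = b := by
        rw [← Finset.sum_mul, ← ENNReal.ofReal_sum_of_nonneg fun i _ => hq.1 i, hq.sum_coeff]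
        simp

lemma eLpNorm_sum_coeff_smul_le {q : ℝ[X]} (hq : IsStochastic q) {g : ℕ → ℝ → ℝ}
    (hg : ∀ i, AEStronglyMeasurable (g i) volume) {p b : ENNReal} (hp : 1 ≤ p)
    (h : ∀ i ∈ Finset.range (q.natDegree + 1), eLpNorm (g i) p volume ≤ b) :
    eLpNorm (∑ i ∈ Finset.range (q.natDegree + 1), q.coeff i • g i) p volume ≤ b := by
  refine (eLpNorm_sum_le (fun i _ => (hg i).const_smul _) hp).trans ?_
  refine le_trans (Finset.sum_le_sum fun i _ => ?_) (sum_ofReal_mul_le hq h)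
  rw [eLpNorm_const_smul, Real.enorm_of_nonneg (hq.1 i)]

lemma eLpNorm_subdiv_le {q : ℝ[X]} (hq : IsStochastic q) {f : ℝ → ℝ}
    (hf : AEStronglyMeasurable f volume) {p : ENNReal} (hp : 1 ≤ p) (s : ℝ) :
    eLpNorm (subdiv q s f) p volume ≤ eLpNorm f p volume := by
  rw [subdiv_eq_sum]
  exact eLpNorm_sum_coeff_smul_le hq (fun i => aestronglyMeasurable_shift hf _) hp
    fun i _ => (eLpNorm_shift hf _ _).le

lemma eLpNorm_subdiv_sub_le {q : ℝ[X]} (hq : IsStochastic q) {f : ℝ → ℝ}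
    (hf : AEStronglyMeasurable f volume) {p b : ENNReal} (hp : 1 ≤ p) (s : ℝ)
    (h : ∀ i ≤ q.natDegree, eLpNorm (shift (i * s) f - f) p volume ≤ b) :
    eLpNorm (subdiv q s f - f) p volume ≤ b := by
  -- The coefficients sum to one, so `f` may be subtracted inside the sum.
  have : subdiv q s f - f =
      ∑ i ∈ Finset.range (q.natDegree + 1), q.coeff i • (shift (i * s) f - f) := by
    simp_rw [smul_sub, Finset.sum_sub_distrib, ← Finset.sum_smul, hq.sum_coeff, subdiv_eq_sum,
      one_smul]
  rw [this]
  exact eLpNorm_sum_coeff_smul_le hq (fun i => (aestronglyMeasurable_shift hf _).sub hf) hp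
    fun i hi => h i (by simpa [Nat.lt_succ_iff] using hi)

/-! ### The box functions -/

lemma box_memLp (m : ℕ) (p : ENNReal) : MemLp (box m) p volume :=
  memLp_indicator_const p measurableSet_Ico _ (Or.inr (by simp))

lemma subdiv_half_box (m : ℕ) :
    subdiv (C (1 / 2) * (1 + X)) (1 / 2 ^ (m + 1)) (box (m + 1)) = box m := by
  ext x
  have h2 : (0 : ℝ) < 1 / 2 ^ (m + 1) := by positivity
  have h : (1 : ℝ) / 2 ^ m = 2 * (1 / 2 ^ (m + 1)) := by rw [pow_succ]; field_simp
  simp only [subdiv, map_mul, map_add, map_one, aeval_C, aeval_X, Module.End.mul_apply,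
    Module.algebraMap_end_apply, LinearMap.add_apply, Module.End.one_apply, Pi.smul_apply,
    Pi.add_apply, shift_apply, smul_eq_mul, box, Set.indicator_apply, Set.mem_Ico, h]
  generalize (1 : ℝ) / 2 ^ (m + 1) = t at h2
  rw [pow_succ]
  split_ifs <;> first | (exfalso; grind) | ring1

lemma eLpNorm_shift_box_sub_le (m : ℕ) {t : ℝ} (ht : 0 ≤ t) {p : ENNReal} (hp : 1 ≤ p)
    (hp' : p ≠ ⊤) :
    eLpNorm (shift t (box m) - box m) p volume ≤
      ENNReal.ofReal (2 * 2 ^ m * t ^ (1 / p.toReal)) := by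
  set L : ℝ := 1 / 2 ^ m with hL
  have hL0 : 0 < L := by positivity
  -- Valid for every `t ≥ 0`: if `t > L`, the overlap of the two intervals cancels.
  have : shift t (box m) - box m = (Set.Ico L (L + t)).indicator (fun _ => (2 : ℝ) ^ m) -
      (Set.Ico 0 t).indicator (fun _ => (2 : ℝ) ^ m) := by
    ext x
    simp only [Pi.sub_apply, shift_apply, box, Set.indicator_apply, Set.mem_Ico, ← hL]
    split_ifs <;> first | (exfalso; grind) | ring1
  rw [this]
  have hp0 : p ≠ 0 := (zero_lt_one.trans_le hp).ne'
  refine (eLpNorm_sub_le ?_ ?_ hp).trans ?_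
  · exact (aestronglyMeasurable_const.indicator measurableSet_Ico)
  · exact (aestronglyMeasurable_const.indicator measurableSet_Ico)
  · rw [eLpNorm_indicator_const measurableSet_Ico hp0 hp',
      eLpNorm_indicator_const measurableSet_Ico hp0 hp', Real.volume_Ico, Real.volume_Ico,
      add_sub_cancel_left, sub_zero, ← two_mul, Real.enorm_of_nonneg (by positivity),
      ENNReal.ofReal_rpow_of_nonneg ht (by positivity), ← ENNReal.ofReal_mul (by positivity),
      mul_assoc, ENNReal.ofReal_mul zero_le_two]
    simp

/-! ### The symbols of the masks -/

/-- The tension factor `2^{m^{-μ}}` of level `m`. -/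
noncomputable def tension (μ : ℝ) (m : ℕ) : ℝ := (2 : ℝ) ^ ((m : ℝ) ^ (-μ))

lemma one_lt_tension (μ : ℝ) {m : ℕ} (hm : m ≠ 0) : 1 < tension μ m :=
  Real.one_lt_rpow one_lt_two (Real.rpow_pos_of_pos (by positivity) _)

/-- The cofactor of `(1 + X) / 2` in the symbol of level `m`. -/
noncomputable def cofactor (n : ℕ) (μ : ℝ) (m : ℕ) : ℝ[X] :=
  if m = 0 then 1 else
    C (1 / (2 ^ n * tension μ m)) *
      ((1 + X) ^ n + C (4 * (tension μ m - 1)) * (X * (1 + X) ^ (n - 2)))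

/-- The symbol of the mask of level `m`. -/
noncomputable def symbol (n : ℕ) (μ : ℝ) (m : ℕ) : ℝ[X] :=
  C (1 / 2) * (1 + X) * cofactor n μ m

lemma symbol_of_ne_zero {n : ℕ} (hn : 2 ≤ n) (μ : ℝ) {m : ℕ} (hm : m ≠ 0) :
    symbol n μ m = C (1 / (2 ^ (n + 1) * tension μ m)) *
      ((1 + X) ^ (n + 1) + C (4 * (tension μ m - 1)) * (X * (1 + X) ^ (n - 1))) := by
  obtain ⟨n, rfl⟩ := Nat.exists_eq_add_of_le' hn
  have : (1 : ℝ) / (2 ^ (n + 2 + 1) * tension μ m) = 1 / 2 * (1 / (2 ^ (n + 2) * tension μ m)) := by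
    rw [pow_succ]
    field_simp
  rw [symbol, cofactor, if_neg hm, this, C_mul (a := 1 / 2)]
  simp only [Nat.add_sub_cancel, Nat.add_succ_sub_one]
  generalize C (1 / (2 ^ (n + 2) * tension μ m)) = c
  generalize C (4 * (tension μ m - 1)) = d
  ring

lemma mask_eq_coeff {n : ℕ} (hn : 2 ≤ n) (μ : ℝ) (m α : ℕ) :
    mask n μ m α = (symbol n μ m).coeff α := by
  by_cases hm : m = 0
  · subst hm
    rcases α with _ | _ | α <;> simp [mask, symbol, cofactor, coeff_one, coeff_X]
  · have h2 : (2 : ℝ) ^ ((n : ℝ) + 1 + (m : ℝ) ^ (-μ)) = 2 ^ (n + 1) * tension μ m := by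
      rw [Real.rpow_add two_pos, tension]
      norm_cast
    rw [symbol_of_ne_zero hn μ hm, mask, if_neg hm, h2, coeff_C_mul, coeff_add, coeff_C_mul,
      coeff_one_add_X_pow]
    rcases α with _ | α
    · simp
    · rw [coeff_X_mul, coeff_one_add_X_pow]
      simp [tension]

lemma natDegree_cofactor_le {n : ℕ} (hn : 2 ≤ n) (μ : ℝ) (m : ℕ) :
    (cofactor n μ m).natDegree ≤ n := by
  unfold cofactor
  split_ifs
  · simp
  · obtain ⟨n, rfl⟩ := Nat.exists_eq_add_of_le' hn
    rw [Nat.add_sub_cancel]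
    have h1 : ((1 + X : ℝ[X])).natDegree ≤ 1 := by compute_degree
    have h2 : ∀ k, ((1 + X : ℝ[X]) ^ k).natDegree ≤ k := fun k =>
      natDegree_pow_le.trans (by nlinarith)
    refine natDegree_C_mul_le _ _ |>.trans (natDegree_add_le_of_degree_le (h2 _) ?_)
    refine natDegree_C_mul_le _ _ |>.trans (natDegree_mul_le.trans ?_)
    rw [natDegree_X]
    linarith [h2 n]

lemma natDegree_symbol_lt {n : ℕ} (hn : 2 ≤ n) (μ : ℝ) (m : ℕ) :
    (symbol n μ m).natDegree < n + 2 := by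
  have h1 : (C (1 / 2) * (1 + X : ℝ[X])).natDegree ≤ 1 := by compute_degree
  have := natDegree_mul_le (p := C (1 / 2) * (1 + X : ℝ[X])) (q := cofactor n μ m)
  have := natDegree_cofactor_le hn μ m
  rw [symbol]
  omega

lemma isStochastic_cofactor {n : ℕ} (hn : 2 ≤ n) (μ : ℝ) (m : ℕ) :
    IsStochastic (cofactor n μ m) := by
  unfold cofactor
  split_ifs with hm
  · refine ⟨fun i => ?_, by simp⟩
    rw [coeff_one]
    positivity
  · have ht := one_lt_tension μ hm
    have ht' : 0 ≤ 4 * (tension μ m - 1) := by linarith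
    refine ⟨fun i => ?_, ?_⟩
    · rw [coeff_C_mul, coeff_add, coeff_C_mul, coeff_one_add_X_pow]
      refine mul_nonneg (by positivity) (add_nonneg (by positivity) (mul_nonneg ht' ?_))
      rcases i with _ | i
      · simp
      · rw [coeff_X_mul, coeff_one_add_X_pow]
        positivity
    · obtain ⟨n, rfl⟩ := Nat.exists_eq_add_of_le' hn
      simp only [one_div, eval_mul, eval_C, eval_add, eval_pow, eval_one, eval_X, one_mul,
        Nat.add_sub_cancel]
      rw [one_add_one_eq_two, pow_add]
      field_simp
      ring

/-! ### The cascade as an averaging of a box function -/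

lemma cascade_succ {n : ℕ} (hn : 2 ≤ n) (μ : ℝ) (k m : ℕ) :
    cascade n μ (k + 1) m = subdiv (symbol n μ m) (1 / 2 ^ (m + 1)) (cascade n μ k (m + 1)) := by
  rw [subdiv, aeval_eq_sum_range' (natDegree_symbol_lt hn μ m)]
  ext x
  simp only [cascade, LinearMap.sum_apply, LinearMap.smul_apply, shift_pow, Finset.sum_apply,
    Pi.smul_apply, shift_apply, smul_eq_mul, mask_eq_coeff hn, mul_one_div]

lemma cascade_memLp {n : ℕ} (hn : 2 ≤ n) (μ : ℝ) (k m : ℕ) (p : ENNReal) :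
    MemLp (cascade n μ k m) p volume := by
  induction k generalizing m with
  | zero => exact box_memLp m p
  | succ k ih =>
    rw [cascade_succ hn]
    exact memLp_subdiv (ih _) _ _

/-- The averaging operator that takes `box m` to the `k`-th iterate of the cascade of level `m`. -/
noncomputable def average (n : ℕ) (μ : ℝ) : ℕ → ℕ → Module.End ℝ (ℝ → ℝ)
  | 0, _ => 1
  | k + 1, m => subdiv (cofactor n μ m) (1 / 2 ^ (m + 1)) * average n μ k (m + 1)

lemma average_commute_shift (n : ℕ) (μ : ℝ) (k m : ℕ) (s : ℝ) :
    Commute (average n μ k m) (shift s) := by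
  induction k generalizing m with
  | zero => exact Commute.one_left _
  | succ k ih =>
    exact ((commute_subdiv (shift_commute s _) _).symm).mul_left (ih _)

/-- The recursion peels the coarsest operator off the left; here the finest comes off the right, so
that consecutive averages share a common contraction. -/
lemma average_succ' (n : ℕ) (μ : ℝ) (k m : ℕ) :
    average n μ (k + 1) m =
      average n μ k m * subdiv (cofactor n μ (m + k)) (1 / 2 ^ (m + k + 1)) := by
  induction k generalizing m with
  | zero => simp [average]
  | succ k ih =>
    rw [average, ih, average, mul_assoc]
    simp only [add_assoc, add_comm 1 k]

/-- Convolutions commute, so the factor $(1+X)/2$ of each symbol can be moved next to the box, where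
it coarsens it by one level. -/
lemma cascade_eq_average {n : ℕ} (hn : 2 ≤ n) (μ : ℝ) (k m : ℕ) :
    cascade n μ k m = average n μ k m (box m) := by
  induction k generalizing m with
  | zero => simp [cascade, average]
  | succ k ih =>
    rw [cascade_succ hn, ih, symbol, mul_comm, subdiv_mul, average, Module.End.mul_apply,
      Module.End.mul_apply]
    congr 1
    rw [← Module.End.mul_apply,
      ← (commute_subdiv (average_commute_shift n μ k (m + 1) _) _).eq, Module.End.mul_apply,
      subdiv_half_box]

lemma memLp_average (n : ℕ) (μ : ℝ) (k m : ℕ) {f : ℝ → ℝ} {p : ENNReal}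
    (hf : MemLp f p volume) : MemLp (average n μ k m f) p volume := by
  induction k generalizing m with
  | zero => exact hf
  | succ k ih => exact memLp_subdiv (ih (m + 1)) _ _

lemma eLpNorm_average_le {n : ℕ} (hn : 2 ≤ n) (μ : ℝ) (k m : ℕ) {f : ℝ → ℝ} {p : ENNReal}
    (hp : 1 ≤ p) (hf : MemLp f p volume) :
    eLpNorm (average n μ k m f) p volume ≤ eLpNorm f p volume := by
  induction k generalizing m with
  | zero => exact le_rfl
  | succ k ih =>
    exact (eLpNorm_subdiv_le (isStochastic_cofactor hn μ m)
      (memLp_average n μ k (m + 1) hf).1 hp _).trans (ih _)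

/-! ### Convergence of the cascade in $L^p$ -/

lemma eLpNorm_cascade_succ_sub_le {n : ℕ} (hn : 2 ≤ n) (μ : ℝ) (k m : ℕ) {p : ENNReal}
    (hp : 1 ≤ p) (hp' : p ≠ ⊤) :
    eLpNorm (cascade n μ (k + 1) m - cascade n μ k m) p volume ≤
      ENNReal.ofReal (2 * 2 ^ m * (n : ℝ) ^ (1 / p.toReal) * ((1 / 2 : ℝ) ^ (1 / p.toReal)) ^ k) := by
  rw [cascade_eq_average hn, cascade_eq_average hn, average_succ', Module.End.mul_apply, ← map_sub]
  refine (eLpNorm_average_le hn μ k m hp ((memLp_subdiv (box_memLp m p) _ _).sub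
    (box_memLp m p))).trans ?_
  refine eLpNorm_subdiv_sub_le (isStochastic_cofactor hn μ _) (box_memLp m p).1 hp _ fun i hi => ?_
  refine (eLpNorm_shift_box_sub_le m (by positivity) hp hp').trans (ENNReal.ofReal_le_ofReal ?_)
  have hi : (i : ℝ) ≤ n := mod_cast hi.trans (natDegree_cofactor_le hn μ _)
  -- The bound regroups as $(n2^{-k})^{1/p}$, leaving $i\,2^{-(m+k+1)}\le n2^{-k}$ to check.
  rw [mul_assoc (2 * 2 ^ m : ℝ), Real.rpow_pow_comm (by norm_num), ←
    Real.mul_rpow (by positivity) (by positivity)]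
  gcongr
  rw [one_div_pow]
  gcongr
  · norm_num
  · omega

lemma exists_cascade_limit {n : ℕ} (hn : 2 ≤ n) (μ : ℝ) (m : ℕ) {p : ENNReal}
    (hp : 1 ≤ p) (hp' : p ≠ ⊤) :
    ∃ f : ℝ → ℝ, MemLp f p volume ∧
      Tendsto (fun k => eLpNorm (cascade n μ k m - f) p volume) atTop (𝓝 0) := by
  have : Fact (1 ≤ p) := ⟨hp⟩
  have hp0 : 0 < p.toReal := ENNReal.toReal_pos (zero_lt_one.trans_le hp).ne' hp'
  have hmem := fun k => cascade_memLp hn μ k m p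
  have hc : CauchySeq fun k => (hmem k).toLp (cascade n μ k m) := by
    refine cauchySeq_of_le_geometric ((1 / 2 : ℝ) ^ (1 / p.toReal))
      (2 * 2 ^ m * (n : ℝ) ^ (1 / p.toReal))
      (Real.rpow_lt_one (by norm_num) (by norm_num) (by positivity)) fun k => ?_
    rw [dist_comm, dist_edist, Lp.edist_toLp_toLp]
    exact ENNReal.toReal_le_of_le_ofReal (by positivity)
      (eLpNorm_cascade_succ_sub_le hn μ k m hp hp')
  obtain ⟨f, hf⟩ := cauchySeq_tendsto_of_complete hc
  refine ⟨f, Lp.memLp f, ?_⟩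
  rw [← Lp.tendsto_Lp_iff_tendsto_eLpNorm'' _ hmem f (Lp.memLp f), Lp.toLp_coeFn]
  exact hf

lemma isCascadeLimit_phi {n : ℕ} (hn : 2 ≤ n) (μ : ℝ) (m : ℕ) :
    IsCascadeLimit n μ m (phi n μ m) := by
  have h : ∃ f, IsCascadeLimit n μ m f :=
    exists_cascade_limit hn μ m (p := 2) one_le_two ENNReal.ofNat_ne_top
  rw [phi, dif_pos h]
  exact h.choose_spec

/-- On the whole line $L^2$ convergence does not give $L^1$ convergence. The cascade also has an
$L^1$ limit, and both limits are limits in measure, hence equal almost everywhere. -/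
lemma phi_memLp_one_and_tendsto {n : ℕ} (hn : 2 ≤ n) (μ : ℝ) (m : ℕ) :
    MemLp (phi n μ m) 1 volume ∧
      Tendsto (fun k => eLpNorm (cascade n μ k m - phi n μ m) 1 volume) atTop (𝓝 0) := by
  obtain ⟨g, hg, hg'⟩ := exists_cascade_limit hn μ m le_rfl ENNReal.one_ne_top
  obtain ⟨hf, hf'⟩ := isCascadeLimit_phi hn μ m
  have hm := fun k => (cascade_memLp hn μ k m 1).1
  have h : g =ᵐ[volume] phi n μ m := tendstoInMeasure_ae_unique
    (tendstoInMeasure_of_tendsto_eLpNorm one_ne_zero hm hg.1 hg')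
    (tendstoInMeasure_of_tendsto_eLpNorm two_ne_zero hm hf.1 hf')
  refine ⟨hg.ae_eq h, hg'.congr fun k => eLpNorm_congr_ae (EventuallyEq.rfl.sub h)⟩

lemma integrable_phi {n : ℕ} (hn : 2 ≤ n) (μ : ℝ) (m : ℕ) : Integrable (phi n μ m) volume :=
  memLp_one_iff_integrable.1 (phi_memLp_one_and_tendsto hn μ m).1

/-! ### Fourier transforms -/

lemma norm_exp_neg_I_mul (ω x : ℝ) : ‖Complex.exp (-(Complex.I * (ω : ℂ) * (x : ℂ)))‖ = 1 := by
  rw [show -(Complex.I * (ω : ℂ) * (x : ℂ)) = ((-(ω * x) : ℝ) : ℂ) * Complex.I by push_cast; ring]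
  exact Complex.norm_exp_ofReal_mul_I _

lemma integrable_mul_exp {f : ℝ → ℝ} (hf : Integrable f volume) (ω : ℝ) :
    Integrable (fun x : ℝ => (f x : ℂ) * Complex.exp (-(Complex.I * (ω : ℂ) * (x : ℂ)))) volume :=
  hf.ofReal.mul_bdd (c := 1) (by fun_prop) (ae_of_all _ fun x => (norm_exp_neg_I_mul ω x).le)

lemma hat_shift (f : ℝ → ℝ) (s ω : ℝ) :
    hat (shift s f) ω = Complex.exp (-(Complex.I * (ω : ℂ) * (s : ℂ))) * hat f ω := by
  rw [hat, hat, ← integral_const_mul, ← integral_sub_right_eq_self (fun x : ℝ =>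
    Complex.exp (-(Complex.I * (ω : ℂ) * (s : ℂ))) *
      ((f x : ℂ) * Complex.exp (-(Complex.I * (ω : ℂ) * (x : ℂ))))) s]
  refine integral_congr_ae (ae_of_all _ fun x => ?_)
  simp only [shift_apply]
  rw [mul_left_comm, ← Complex.exp_add]
  congr 2
  push_cast
  ring

lemma hat_subdiv {f : ℝ → ℝ} (hf : Integrable f volume) (p : ℝ[X]) (s ω : ℝ) :
    hat (subdiv p s f) ω =
      aeval (Complex.exp (-(Complex.I * (ω : ℂ) * (s : ℂ)))) p * hat f ω := by
  have h : ∀ i : ℕ, (p.coeff i : ℂ) * hat (shift (i * s) f) ω =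
      ∫ x, (p.coeff i : ℂ) *
        ((shift (i * s) f x : ℂ) * Complex.exp (-(Complex.I * (ω : ℂ) * (x : ℂ)))) :=
    fun i => (integral_const_mul _ _).symm
  have hi : ∀ i : ℕ, Integrable (shift (i * s) f) volume := fun i => hf.comp_sub_right _
  rw [aeval_eq_sum_range, Finset.sum_mul]
  trans ∑ i ∈ Finset.range (p.natDegree + 1), (p.coeff i : ℂ) * hat (shift (i * s) f) ω
  · simp_rw [h]
    rw [← integral_finsetSum _ fun i _ => (integrable_mul_exp (hi i) ω).const_mul _, hat]
    refine integral_congr_ae (ae_of_all _ fun x => ?_)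
    simp [subdiv_eq_sum, Finset.sum_mul, mul_assoc]
  · refine Finset.sum_congr rfl fun i _ => ?_
    rw [hat_shift, ← Complex.exp_nat_mul, Complex.real_smul, ← mul_assoc]
    congr 3
    push_cast
    ring

lemma tendsto_hat {F : ℕ → ℝ → ℝ} {f : ℝ → ℝ} (hF : ∀ k, Integrable (F k) volume)
    (hf : Integrable f volume)
    (h : Tendsto (fun k => eLpNorm (F k - f) 1 volume) atTop (𝓝 0)) (ω : ℝ) :
    Tendsto (fun k => hat (F k) ω) atTop (𝓝 (hat f ω)) := by
  refine tendsto_integral_of_L1' _ (integrable_mul_exp hf ω).1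
    (Eventually.of_forall fun k => integrable_mul_exp (hF k) ω) (h.congr fun k => ?_)
  refine eLpNorm_congr_norm_ae (ae_of_all _ fun x => ?_)
  rw [Pi.sub_apply, Pi.sub_apply, ← sub_mul, norm_mul, norm_exp_neg_I_mul, mul_one,
    ← Complex.ofReal_sub, Complex.norm_real]

/-- The Fourier transform `(1 - e^{-iu}) / (iu)` of the unit box. -/
noncomputable def boxHat (u : ℂ) : ℂ := (1 - Complex.exp (-(Complex.I * u))) / (Complex.I * u)

lemma boxHat_two_mul (u : ℂ) :
    boxHat (2 * u) = (1 + Complex.exp (-(Complex.I * u))) / 2 * boxHat u := by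
  have : Complex.exp (-(Complex.I * (2 * u))) = Complex.exp (-(Complex.I * u)) ^ 2 := by
    rw [← Complex.exp_nat_mul]
    congr 1
    push_cast
    ring
  rcases eq_or_ne u 0 with rfl | hu
  · simp [boxHat]
  · rw [boxHat, boxHat, this]
    field_simp [Complex.I_ne_zero]
    ring

/-- The quotient is the slope at 0 of $-e^{-iu}/i$. The limit is punctured because division by zero
gives `boxHat 0 = 0`. -/
lemma tendsto_boxHat : Tendsto boxHat (𝓝[≠] 0) (𝓝 1) := by
  have h : HasDerivAt (fun u : ℂ => -Complex.exp (-(Complex.I * u)) / Complex.I) 1 0 := by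
    have h1 : HasDerivAt (fun u : ℂ => -(Complex.I * u)) (-(Complex.I * 1)) 0 :=
      ((hasDerivAt_id 0).const_mul Complex.I).neg
    refine (h1.cexp.neg.div_const Complex.I).congr_deriv ?_
    simp
  refine h.tendsto_slope_zero.congr fun u => ?_
  simp only [boxHat, smul_eq_mul]
  by_cases hu : u = 0
  · simp [hu]
  · simp only [zero_add, mul_zero, neg_zero, Complex.exp_zero]
    field_simp [Complex.I_ne_zero]
    ring

lemma hat_box (m : ℕ) {ω : ℝ} (hω : ω ≠ 0) : hat (box m) ω = boxHat ((ω : ℂ) / 2 ^ m) := by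
  have h : ∀ x : ℝ, ((box m x : ℝ) : ℂ) * Complex.exp (-(Complex.I * (ω : ℂ) * (x : ℂ))) =
      (Set.Ico (0 : ℝ) (1 / 2 ^ m)).indicator
        (fun x : ℝ => 2 ^ m * Complex.exp (-(Complex.I * (ω : ℂ)) * (x : ℂ))) x := by
    intro x
    simp only [box, Set.indicator_apply]
    split_ifs <;> simp
  have hc : -(Complex.I * (ω : ℂ)) ≠ 0 := by simp [hω]
  have hω' : (ω : ℂ) ≠ 0 := mod_cast hω
  rw [hat, integral_congr_ae (ae_of_all _ h), integral_indicator measurableSet_Ico,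
    integral_Ico_eq_integral_Ioc, ← intervalIntegral.integral_of_le (by positivity),
    intervalIntegral.integral_const_mul, integral_exp_mul_complex hc, boxHat]
  have : -(Complex.I * (ω : ℂ)) * ((1 / 2 ^ m : ℝ) : ℂ) = -(Complex.I * (ω / 2 ^ m)) := by
    push_cast
    ring
  rw [this]
  simp only [Complex.ofReal_zero, mul_zero, Complex.exp_zero]
  field_simp [Complex.I_ne_zero]
  ring

/-- The point `e^{-iz / 2^{j+1}}` at which the symbol of level `j` is evaluated. -/
noncomputable def node (j : ℕ) (z : ℂ) : ℂ :=
  Complex.exp (-(Complex.I * z * ((1 / 2 ^ (j + 1) : ℝ) : ℂ)))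

lemma boxHat_eq_node_mul (m : ℕ) (z : ℂ) :
    boxHat (z / 2 ^ m) = (1 + node m z) / 2 * boxHat (z / 2 ^ (m + 1)) := by
  rw [show z / 2 ^ m = 2 * (z / 2 ^ (m + 1)) by rw [pow_succ]; field_simp, boxHat_two_mul, node]
  congr 5
  push_cast
  ring

/-- The factor of the symbol of level `j` that remains after division by `((1 + w) / 2)^(n - 1)`. -/
noncomputable def tensionFactor (μ : ℝ) (j : ℕ) (w : ℂ) : ℂ :=
  ((1 + w) ^ 2 + 4 * (tension μ j - 1) * w) / (4 * tension μ j)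

lemma aeval_symbol {n : ℕ} (hn : 2 ≤ n) (μ : ℝ) {j : ℕ} (hj : j ≠ 0) (w : ℂ) :
    aeval w (symbol n μ j) = ((1 + w) / 2) ^ (n - 1) * tensionFactor μ j w := by
  have ht : (tension μ j : ℂ) ≠ 0 := mod_cast (zero_lt_one.trans (one_lt_tension μ hj)).ne'
  rw [symbol_of_ne_zero hn μ hj, tensionFactor]
  obtain ⟨n, rfl⟩ := Nat.exists_eq_add_of_le' hn
  simp only [Nat.add_succ_sub_one, map_mul, map_add, map_pow, map_one, aeval_C, aeval_X,
    Complex.coe_algebraMap, div_pow]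
  push_cast
  field_simp
  ring

lemma hat_cascade_succ {n : ℕ} (hn : 2 ≤ n) (μ : ℝ) (k m : ℕ) (ω : ℝ) :
    hat (cascade n μ (k + 1) m) ω =
      aeval (node m ω) (symbol n μ m) * hat (cascade n μ k (m + 1)) ω := by
  rw [cascade_succ hn, hat_subdiv (memLp_one_iff_integrable.1 (cascade_memLp hn μ k _ 1)), node]

lemma tendsto_hat_cascade {n : ℕ} (hn : 2 ≤ n) (μ : ℝ) (m : ℕ) (ω : ℝ) :
    Tendsto (fun k => hat (cascade n μ k m) ω) atTop (𝓝 (hat (phi n μ m) ω)) :=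
  tendsto_hat (fun k => memLp_one_iff_integrable.1 (cascade_memLp hn μ k _ 1))
    (integrable_phi hn μ m) (phi_memLp_one_and_tendsto hn μ m).2 ω

lemma hat_phi_eq_mul {n : ℕ} (hn : 2 ≤ n) (μ : ℝ) (m : ℕ) (ω : ℝ) :
    hat (phi n μ m) ω = aeval (node m ω) (symbol n μ m) * hat (phi n μ (m + 1)) ω := by
  refine tendsto_nhds_unique ((tendsto_hat_cascade hn μ m ω).comp (tendsto_add_atTop_nat 1)) ?_
  refine ((tendsto_hat_cascade hn μ (m + 1) ω).const_mul _).congr fun k => ?_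
  exact (hat_cascade_succ hn μ k m ω).symm

/-- The powers of $(1+w)/2$ telescope by `boxHat_eq_node_mul`. The denominator is kept on the left
since `boxHat` may vanish at $\omega/2^{m+k}$ for small `k`; the last factor on the right is the
transform of the starting box. -/
lemma hat_cascade_mul {n : ℕ} (hn : 2 ≤ n) (μ : ℝ) (k : ℕ) {m : ℕ} (hm : m ≠ 0) {ω : ℝ}
    (hω : ω ≠ 0) :
    hat (cascade n μ k m) ω * boxHat ((ω : ℂ) / 2 ^ (m + k)) ^ (n - 1) =
      boxHat ((ω : ℂ) / 2 ^ m) ^ (n - 1) *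
        (∏ j ∈ Finset.range k, tensionFactor μ (m + j) (node (m + j) ω)) *
          boxHat ((ω : ℂ) / 2 ^ (m + k)) := by
  induction k generalizing m with
  | zero => simp [cascade, hat_box m hω, mul_comm]
  | succ k ih =>
    have h := ih (Nat.succ_ne_zero m)
    simp only [Nat.succ_eq_add_one, add_assoc, add_comm 1] at h
    rw [hat_cascade_succ hn, aeval_symbol hn μ hm, mul_assoc, h, boxHat_eq_node_mul m,
      Finset.prod_range_succ', mul_pow]
    simp only [add_zero]
    ring

/-! ### The infinite product: convergence, analyticity, nonvanishing -/

/-- The infinite product of the tension factors of the levels `m, m + 1, …`. -/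
noncomputable def tensionProd (μ : ℝ) (m : ℕ) (z : ℂ) : ℂ :=
  ∏' j : ℕ, tensionFactor μ (m + j) (node (m + j) z)

lemma tensionFactor_sub_one (μ : ℝ) {j : ℕ} (hj : j ≠ 0) (w : ℂ) :
    tensionFactor μ j w - 1 =
      (w - 1) * ((w + 3 + 4 * (tension μ j - 1)) / (4 * tension μ j)) := by
  have ht : (tension μ j : ℂ) ≠ 0 := mod_cast (zero_lt_one.trans (one_lt_tension μ hj)).ne'
  rw [tensionFactor]
  field_simp
  ring

lemma norm_node_sub_one_le (j : ℕ) (z : ℂ) :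
    ‖node j z - 1‖ ≤ ‖z‖ * Real.exp ‖z‖ * (1 / 2) ^ j := by
  have h := Complex.norm_exp_sub_sum_le_norm_mul_exp
    (-(Complex.I * z * ((1 / 2 ^ (j + 1) : ℝ) : ℂ))) 1
  rw [Finset.sum_range_one, pow_zero, Nat.factorial_zero, Nat.cast_one, div_one, pow_one] at h
  have h1 : ‖-(Complex.I * z * ((1 / 2 ^ (j + 1) : ℝ) : ℂ))‖ = ‖z‖ * (1 / 2) ^ (j + 1) := by
    rw [norm_neg, norm_mul, norm_mul, Complex.norm_I, one_mul, Complex.norm_real,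
      Real.norm_of_nonneg (by positivity), one_div_pow]
  rw [h1] at h
  have h2 : ((1 : ℝ) / 2) ^ (j + 1) ≤ (1 / 2) ^ j :=
    pow_le_pow_of_le_one (by norm_num) (by norm_num) (Nat.le_succ j)
  have h3 : ((1 : ℝ) / 2) ^ (j + 1) ≤ 1 := pow_le_one₀ (by norm_num) (by norm_num)
  refine h.trans ?_
  calc ‖z‖ * (1 / 2) ^ (j + 1) * Real.exp (‖z‖ * (1 / 2) ^ (j + 1))
      ≤ ‖z‖ * (1 / 2) ^ j * Real.exp (‖z‖ * 1) := by gcongr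
    _ = _ := by rw [mul_one]; ring

/-- The factor equals 1 at $w=1$, and its difference quotient there is bounded uniformly in the
tension; with $w-1=O(2^{-j})$ at the nodes this gives a summable bound. -/
lemma norm_tensionFactor_sub_one_le (μ : ℝ) {j : ℕ} (hj : j ≠ 0) (w : ℂ) :
    ‖tensionFactor μ j w - 1‖ ≤ ‖w - 1‖ * (‖w - 1‖ + 2) := by
  have ht := one_lt_tension μ hj
  rw [tensionFactor_sub_one μ hj, norm_mul]
  gcongr
  have h : w + 3 + 4 * ((tension μ j : ℂ) - 1) = (w - 1) + ((4 * tension μ j : ℝ) : ℂ) := by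
    push_cast
    ring
  have h4 : (4 * tension μ j : ℂ) = ((4 * tension μ j : ℝ) : ℂ) := by push_cast; ring
  rw [h, h4, norm_div, Complex.norm_real, Real.norm_of_nonneg (by linarith),
    div_le_iff₀ (by linarith)]
  refine (norm_add_le _ _).trans ?_
  rw [Complex.norm_real, Real.norm_of_nonneg (by linarith)]
  nlinarith [norm_nonneg (w - 1)]

lemma norm_tensionFactor_node_sub_one_le (μ : ℝ) {m : ℕ} (hm : m ≠ 0) {K : ℝ} {z : ℂ}
    (hz : ‖z‖ ≤ K) (j : ℕ) :
    ‖tensionFactor μ (m + j) (node (m + j) z) - 1‖ ≤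
      (K * Real.exp K * (K * Real.exp K + 2)) * (1 / 2) ^ j := by
  have hK : 0 ≤ K := (norm_nonneg z).trans hz
  have h1 : ‖node (m + j) z - 1‖ ≤ K * Real.exp K * (1 / 2) ^ j := by
    refine (norm_node_sub_one_le _ _).trans ?_
    have : (1 / 2 : ℝ) ^ (m + j) ≤ (1 / 2) ^ j :=
      pow_le_pow_of_le_one (by norm_num) (by norm_num) (Nat.le_add_left _ _)
    gcongr
  have h2 : K * Real.exp K * (1 / 2 : ℝ) ^ j ≤ K * Real.exp K :=
    mul_le_of_le_one_right (by positivity) (pow_le_one₀ (by norm_num) (by norm_num))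
  refine (norm_tensionFactor_sub_one_le μ (by omega) _).trans ?_
  calc _ ≤ (K * Real.exp K * (1 / 2) ^ j) * (K * Real.exp K + 2) := by
        gcongr
        exact h1.trans h2
    _ = _ := by ring

lemma summable_const_mul_half_pow (c : ℝ) : Summable fun j : ℕ => c * (1 / 2 : ℝ) ^ j :=
  (summable_geometric_of_lt_one (by norm_num) (by norm_num)).mul_left c

lemma summable_norm_tensionFactor_sub_one (μ : ℝ) {m : ℕ} (hm : m ≠ 0) (z : ℂ) :
    Summable fun j => ‖tensionFactor μ (m + j) (node (m + j) z) - 1‖ :=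
  Summable.of_nonneg_of_le (fun _ => norm_nonneg _)
    (norm_tensionFactor_node_sub_one_le μ hm le_rfl) (summable_const_mul_half_pow _)

lemma tendsto_tensionProd (μ : ℝ) {m : ℕ} (hm : m ≠ 0) (z : ℂ) :
    Tendsto (fun k => ∏ j ∈ Finset.range k, tensionFactor μ (m + j) (node (m + j) z)) atTop
      (𝓝 (tensionProd μ m z)) := by
  have h := multipliable_one_add_of_summable (summable_norm_tensionFactor_sub_one μ hm z)
  simp only [add_sub_cancel] at h
  exact h.hasProd.tendsto_prod_nat

lemma differentiable_tensionFactor_node (μ : ℝ) (j : ℕ) :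
    Differentiable ℂ fun z => tensionFactor μ j (node j z) := by
  unfold tensionFactor node
  fun_prop

lemma differentiable_tensionProd (μ : ℝ) {m : ℕ} (hm : m ≠ 0) :
    Differentiable ℂ (tensionProd μ m) := by
  intro z
  have h := Summable.hasProdLocallyUniformlyOn_nat_one_add
    (f := fun j z => tensionFactor μ (m + j) (node (m + j) z) - 1)
    (K := Metric.ball (0 : ℂ) (‖z‖ + 1)) Metric.isOpen_ball (summable_const_mul_half_pow _)
    (Eventually.of_forall fun j x hx =>
      norm_tensionFactor_node_sub_one_le μ hm (mem_ball_zero_iff.1 hx).le j)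
    (fun j => ((differentiable_tensionFactor_node μ (m + j)).sub_const 1).continuous.continuousOn)
  simp only [add_sub_cancel] at h
  refine (h.differentiableOn (.of_forall fun s => ?_) Metric.isOpen_ball).differentiableAt
    (Metric.isOpen_ball.mem_nhds (by simp))
  exact (Differentiable.fun_finsetProd fun j _ =>
    differentiable_tensionFactor_node μ (m + j)).differentiableOn

lemma tensionFactor_ne_zero (μ : ℝ) {j : ℕ} (hj : j ≠ 0) {w : ℂ} (hw : ‖w‖ = 1) :
    tensionFactor μ j w ≠ 0 := by
  have ht := one_lt_tension μ hj
  have hw1 : w.re * w.re + w.im * w.im = 1 := by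
    rw [← Complex.normSq_apply, Complex.normSq_eq_norm_sq, hw, one_pow]
  rw [tensionFactor]
  refine div_ne_zero (fun h => ?_) (mod_cast (by positivity : 4 * tension μ j ≠ 0))
  have hre := congrArg Complex.re h
  have him := congrArg Complex.im h
  simp [pow_two] at hre him
  -- Real part of the numerator times $\bar w$, using $|w|=1$; it is positive since
  -- $\operatorname{Re}w\ge-1$ and the tension exceeds 1.
  have h2 : 2 + 2 * w.re + 4 * (tension μ j - 1) = 0 := by
    linear_combination w.re * hre + w.im * him - (w.re + 2 + 4 * (tension μ j - 1)) * hw1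
  have h3 := neg_le_of_abs_le ((Complex.abs_re_le_norm w).trans hw.le)
  linarith

lemma tensionProd_ne_zero (μ : ℝ) {m : ℕ} (hm : m ≠ 0) (ω : ℝ) : tensionProd μ m ω ≠ 0 := by
  have h := tprod_one_add_ne_zero_of_summable
    (f := fun j => tensionFactor μ (m + j) (node (m + j) ω) - 1) (fun j => ?_)
    (summable_norm_tensionFactor_sub_one μ hm ω)
  · simpa only [add_sub_cancel, tensionProd] using h
  · rw [add_sub_cancel]
    exact tensionFactor_ne_zero μ (by omega) (norm_exp_neg_I_mul _ _)

/-- The closed form of the Fourier transform of `phi n μ m`, for `m ≥ 1`, off the origin. -/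
noncomputable def phiHat (n : ℕ) (μ : ℝ) (m : ℕ) (z : ℂ) : ℂ :=
  boxHat (z / 2 ^ m) ^ (n - 1) * tensionProd μ m z

lemma hat_phi {n : ℕ} (hn : 2 ≤ n) (μ : ℝ) {m : ℕ} (hm : m ≠ 0) {ω : ℝ} (hω : ω ≠ 0) :
    hat (phi n μ m) ω = phiHat n μ m ω := by
  have hω' : (ω : ℂ) ≠ 0 := mod_cast hω
  have h1 : Tendsto (fun k : ℕ => boxHat ((ω : ℂ) / 2 ^ (m + k))) atTop (𝓝 1) := by
    refine tendsto_boxHat.comp (tendsto_nhdsWithin_iff.2 ⟨?_, .of_forall fun k => ?_⟩)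
    · have : Tendsto (fun k : ℕ => (ω : ℂ) / 2 ^ m * (1 / 2) ^ k) atTop (𝓝 (ω / 2 ^ m * 0)) :=
        (tendsto_pow_atTop_nhds_zero_of_norm_lt_one (by norm_num)).const_mul _
      rw [mul_zero] at this
      refine this.congr fun k => ?_
      rw [pow_add, one_div_pow]
      field_simp
    · simp [hω]
  have h2 := (tendsto_hat_cascade hn μ m ω).mul (h1.pow (n - 1))
  have h3 := ((tendsto_tensionProd μ hm ω).const_mul (boxHat ((ω : ℂ) / 2 ^ m) ^ (n - 1))).mul h1
  rw [one_pow, mul_one] at h2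
  rw [mul_one] at h3
  exact tendsto_nhds_unique h2 (h3.congr fun k => (hat_cascade_mul hn μ k hm hω).symm)

/-! ### Orders of zeros -/

/-- The local factorization $(z-x)^k g(z)$ with $g(x)\ne0$ restricts to the real line, so orders can
be computed in the complex variable. -/
lemma analyticOrderAt_comp_ofReal {F : ℂ → ℂ} {x : ℝ} {k : ℕ} (hF : AnalyticAt ℂ F x)
    (h : analyticOrderAt F (x : ℂ) = k) : analyticOrderAt (fun t : ℝ => F t) x = k := by
  have hof : ∀ {G : ℂ → ℂ}, AnalyticAt ℂ G x → AnalyticAt ℝ (fun t : ℝ => G t) x := fun hG =>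
    (hG.restrictScalars (𝕜 := ℝ)).comp (Complex.ofRealCLM.analyticAt x)
  obtain ⟨g, hg, hg0, hFg⟩ := hF.analyticOrderAt_eq_natCast.1 h
  refine (hof hF).analyticOrderAt_eq_natCast.2 ⟨fun t => g t, hof hg, hg0, ?_⟩
  filter_upwards [Complex.continuous_ofReal.continuousAt.eventually hFg] with t ht
  rw [ht]
  simp

lemma analyticOrderAt_eq_one_of_hasDerivAt {F : ℂ → ℂ} {z d : ℂ} (hF : AnalyticAt ℂ F z)
    (h0 : F z = 0) (hd : HasDerivAt F d z) (hd0 : d ≠ 0) : analyticOrderAt F z = 1 := by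
  have := hF.analyticOrderAt_sub_eq_one_of_deriv_ne_zero (by rwa [hd.deriv])
  simpa [h0] using this

lemma analyticAt_boxHat_div (m : ℕ) {z : ℂ} (hz : z ≠ 0) :
    AnalyticAt ℂ (fun z => boxHat (z / 2 ^ m)) z := by
  unfold boxHat
  have : Complex.I * (z / 2 ^ m) ≠ 0 := by simp [hz]
  fun_prop (disch := assumption)

lemma analyticAt_phiHat (n : ℕ) (μ : ℝ) {m : ℕ} (hm : m ≠ 0) {z : ℂ} (hz : z ≠ 0) :
    AnalyticAt ℂ (phiHat n μ m) z :=
  ((analyticAt_boxHat_div m hz).pow _).mul ((differentiable_tensionProd μ hm).analyticAt z)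

lemma exp_neg_I_mul_two_pi_int (α : ℤ) :
    Complex.exp (-(Complex.I * (2 * Real.pi * α))) = 1 := by
  rw [Complex.exp_eq_one_iff]
  exact ⟨-α, by push_cast; ring⟩

lemma analyticOrderAt_boxHat_div (m : ℕ) {α : ℤ} (hα : α ≠ 0) :
    analyticOrderAt (fun z => boxHat (z / 2 ^ m)) (2 ^ (m + 1) * Real.pi * α : ℂ) = 1 := by
  set z₀ : ℂ := 2 ^ (m + 1) * Real.pi * α with hz₀
  have hz : z₀ ≠ 0 := by simp [hz₀, hα, Real.pi_ne_zero]
  have he : Complex.exp (-(Complex.I * (z₀ / 2 ^ m))) = 1 := by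
    rw [← exp_neg_I_mul_two_pi_int α, hz₀, pow_succ]
    congr 3
    field_simp
  have hd0 : Complex.I * (z₀ / 2 ^ m) ≠ 0 := by simp [hz]
  have h1 : HasDerivAt (fun z : ℂ => Complex.I * (z / 2 ^ m)) (Complex.I * (1 / 2 ^ m)) z₀ :=
    ((hasDerivAt_id z₀).div_const _).const_mul _
  have h2 := (h1.neg.cexp.const_sub 1).div h1 hd0
  refine analyticOrderAt_eq_one_of_hasDerivAt (analyticAt_boxHat_div m hz) ?_ h2 ?_
  · simp [boxHat, he]
  · simp [he, hz]

lemma analyticOrderAt_phiHat (n : ℕ) (μ : ℝ) {m : ℕ} (hm : m ≠ 0) {α : ℤ} (hα : α ≠ 0) :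
    analyticOrderAt (phiHat n μ m) (2 ^ (m + 1) * Real.pi * α : ℂ) = (n - 1 : ℕ) := by
  have hz : (2 ^ (m + 1) * Real.pi * α : ℂ) ≠ 0 := by simp [hα, Real.pi_ne_zero]
  have hne : tensionProd μ m (2 ^ (m + 1) * Real.pi * α : ℂ) ≠ 0 := by
    simpa using tensionProd_ne_zero μ hm (2 ^ (m + 1) * Real.pi * α)
  have hP := (differentiable_tensionProd μ hm).analyticAt (2 ^ (m + 1) * Real.pi * α : ℂ)
  have hB := analyticAt_boxHat_div m hz
  have := analyticOrderAt_mul (hB.pow (n - 1)) hP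
  rw [analyticOrderAt_pow hB, analyticOrderAt_boxHat_div m hα,
    hP.analyticOrderAt_eq_zero.2 hne, add_zero, nsmul_one] at this
  exact this

/-! ### Orders of the transforms on the real line -/

lemma hat_phi_eventuallyEq {n : ℕ} (hn : 2 ≤ n) (μ : ℝ) {m : ℕ} (hm : m ≠ 0) {ω : ℝ}
    (hω : ω ≠ 0) : hat (phi n μ m) =ᶠ[𝓝 ω] fun t : ℝ => phiHat n μ m t := by
  filter_upwards [isOpen_ne.mem_nhds hω] with t ht using hat_phi hn μ hm ht

lemma hat_phi_zero_eventuallyEq {n : ℕ} (hn : 2 ≤ n) (μ : ℝ) {ω : ℝ} (hω : ω ≠ 0) :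
    hat (phi n μ 0) =ᶠ[𝓝 ω] fun t : ℝ => (1 + node 0 t) / 2 * phiHat n μ 1 t := by
  filter_upwards [isOpen_ne.mem_nhds hω] with t ht
  rw [hat_phi_eq_mul hn, zero_add, hat_phi hn μ one_ne_zero ht]
  simp only [symbol, cofactor, if_true, mul_one, map_mul, map_add, map_one, aeval_X, aeval_C]
  push_cast
  ring

lemma analyticOrderAt_hat_phi {n : ℕ} (hn : 2 ≤ n) (μ : ℝ) {m : ℕ} (hm : m ≠ 0) {α : ℤ}
    (hα : α ≠ 0) :
    analyticOrderAt (hat (phi n μ m)) ((2 : ℝ) ^ (m + 1) * Real.pi * (α : ℝ)) =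
      ((n - 1 : ℕ) : ℕ∞) := by
  have hz : (2 : ℝ) ^ (m + 1) * Real.pi * (α : ℝ) ≠ 0 := by simp [hα, Real.pi_ne_zero]
  rw [analyticOrderAt_congr (hat_phi_eventuallyEq hn μ hm hz)]
  refine analyticOrderAt_comp_ofReal (analyticAt_phiHat n μ hm (mod_cast hz)) ?_
  rw [← analyticOrderAt_phiHat n μ hm hα]
  congr 1
  push_cast
  ring

lemma differentiable_half_one_add_node : Differentiable ℂ fun z => (1 + node 0 z) / 2 := by
  unfold node
  fun_prop

lemma analyticOrderAt_hat_phi_zero {n : ℕ} (hn : 2 ≤ n) (μ : ℝ) {ω : ℝ} (hω : ω ≠ 0) {k : ℕ}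
    (h : analyticOrderAt (fun z => (1 + node 0 z) / 2) (ω : ℂ) +
      analyticOrderAt (phiHat n μ 1) (ω : ℂ) = k) :
    analyticOrderAt (hat (phi n μ 0)) ω = k := by
  have h1 := differentiable_half_one_add_node.analyticAt (ω : ℂ)
  have h2 := analyticAt_phiHat n μ one_ne_zero (z := (ω : ℂ)) (mod_cast hω)
  rw [analyticOrderAt_congr (hat_phi_zero_eventuallyEq hn μ hω)]
  exact analyticOrderAt_comp_ofReal (h1.mul h2) ((analyticOrderAt_mul h1 h2).trans h)

lemma node_zero_eq (α : ℤ) :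
    node 0 ((2 * Real.pi * (α : ℝ) : ℝ) : ℂ) = Complex.exp (-(Complex.I * (Real.pi * α))) := by
  rw [node]
  congr 2
  push_cast
  ring

lemma exp_neg_I_mul_pi_odd {α : ℤ} (h : Odd α) :
    Complex.exp (-(Complex.I * (Real.pi * α))) = -1 := by
  obtain ⟨β, rfl⟩ := h
  rw [show -(Complex.I * (Real.pi * ((2 * β + 1 : ℤ) : ℂ))) =
    -(Complex.I * (2 * Real.pi * β)) + -(Real.pi * Complex.I) by push_cast; ring, Complex.exp_add,
    exp_neg_I_mul_two_pi_int, Complex.exp_neg, Complex.exp_pi_mul_I]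
  norm_num

lemma analyticOrderAt_hat_phi_zero_odd {n : ℕ} (hn : 2 ≤ n) (μ : ℝ) {α : ℤ} (hα : Odd α) :
    analyticOrderAt (hat (phi n μ 0)) (2 * Real.pi * (α : ℝ)) = 1 := by
  have hα0 : α ≠ 0 := by rintro rfl; simp at hα
  have hz : 2 * Real.pi * (α : ℝ) ≠ 0 := by simp [hα0, Real.pi_ne_zero]
  have hnode := (node_zero_eq α).trans (exp_neg_I_mul_pi_odd hα)
  have h1 : analyticOrderAt (fun z => (1 + node 0 z) / 2) ((2 * Real.pi * (α : ℝ) : ℝ) : ℂ) = 1 := by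
    have hd : HasDerivAt (fun z : ℂ => -(Complex.I * z * ((1 / 2 ^ (0 + 1) : ℝ) : ℂ)))
        (-(Complex.I * 1 * ((1 / 2 ^ (0 + 1) : ℝ) : ℂ))) ((2 * Real.pi * (α : ℝ) : ℝ) : ℂ) :=
      (((hasDerivAt_id _).const_mul _).mul_const _).neg
    refine analyticOrderAt_eq_one_of_hasDerivAt
      (differentiable_half_one_add_node.analyticAt _) ?_ ((hd.cexp.const_add 1).div_const 2) ?_
    · rw [hnode]
      simp
    · simp [Complex.exp_ne_zero]
  have h2 : analyticOrderAt (phiHat n μ 1) ((2 * Real.pi * (α : ℝ) : ℝ) : ℂ) = 0 := by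
    rw [(analyticAt_phiHat n μ one_ne_zero (mod_cast hz)).analyticOrderAt_eq_zero, phiHat]
    refine mul_ne_zero (pow_ne_zero _ ?_) (tensionProd_ne_zero μ one_ne_zero _)
    -- At $\pi\alpha$ with $\alpha$ odd the numerator of `boxHat` is $1-(-1)=2$.
    rw [show ((2 * Real.pi * (α : ℝ) : ℝ) : ℂ) / 2 ^ 1 = Real.pi * α by push_cast; ring, boxHat,
      exp_neg_I_mul_pi_odd hα]
    refine div_ne_zero (by norm_num) ?_
    simp [hα0, Real.pi_ne_zero]
  exact_mod_cast analyticOrderAt_hat_phi_zero hn μ hz (k := 1) (by rw [h1, h2]; simp)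

lemma analyticOrderAt_hat_phi_zero_even {n : ℕ} (hn : 2 ≤ n) (μ : ℝ) {α : ℤ} (hα0 : α ≠ 0)
    (hα : Even α) :
    analyticOrderAt (hat (phi n μ 0)) (2 * Real.pi * (α : ℝ)) = ((n - 1 : ℕ) : ℕ∞) := by
  have hz : 2 * Real.pi * (α : ℝ) ≠ 0 := by simp [hα0, Real.pi_ne_zero]
  obtain ⟨β, rfl⟩ := even_iff_two_dvd.1 hα
  have hβ : β ≠ 0 := by rintro rfl; simp at hα0
  refine analyticOrderAt_hat_phi_zero hn μ hz ?_
  have h1 : analyticOrderAt (fun z => (1 + node 0 z) / 2)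
      ((2 * Real.pi * ((2 * β : ℤ) : ℝ) : ℝ) : ℂ) = 0 := by
    rw [(differentiable_half_one_add_node.analyticAt _).analyticOrderAt_eq_zero, node_zero_eq,
      show (Real.pi * ((2 * β : ℤ) : ℂ) : ℂ) = 2 * Real.pi * β by push_cast; ring,
      exp_neg_I_mul_two_pi_int]
    norm_num
  -- With $\alpha=2\beta$ the point is $2^{1+1}\pi\beta$, a level 1 zero.
  rw [h1, zero_add, ← analyticOrderAt_phiHat n μ one_ne_zero hβ]
  congr 1
  push_cast
  ring

end Ripplet

theorem mainTheorem2 (n : ℕ) (hn : 2 ≤ n) (μ : ℝ) (hμ : 1 < μ) :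
    (∀ m : ℕ, Ripplet.IsCascadeLimit n μ m (Ripplet.phi n μ m) ∧
      MeasureTheory.Integrable (Ripplet.phi n μ m) MeasureTheory.volume) ∧
    (∀ m : ℕ, 0 < m → ∀ α : ℤ, α ≠ 0 →
      analyticOrderAt (Ripplet.hat (Ripplet.phi n μ m))
        ((2 : ℝ) ^ (m + 1) * Real.pi * (α : ℝ)) = ((n - 1 : ℕ) : ℕ∞)) ∧
    (∀ α : ℤ, α ≠ 0 →
      1 ≤ analyticOrderAt (Ripplet.hat (Ripplet.phi n μ 0)) (2 * Real.pi * (α : ℝ)) ∧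
      (Odd α →
        analyticOrderAt (Ripplet.hat (Ripplet.phi n μ 0)) (2 * Real.pi * (α : ℝ)) = 1) ∧
      (Even α →
        analyticOrderAt (Ripplet.hat (Ripplet.phi n μ 0)) (2 * Real.pi * (α : ℝ)) =
          ((n - 1 : ℕ) : ℕ∞))) := by
  refine ⟨fun m => ⟨Ripplet.isCascadeLimit_phi hn μ m, Ripplet.integrable_phi hn μ m⟩,
    fun m hm α hα => Ripplet.analyticOrderAt_hat_phi hn μ hm.ne' hα, fun α hα => ?_⟩
  have hodd := fun h : Odd α => Ripplet.analyticOrderAt_hat_phi_zero_odd hn μ h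
  have heven := fun h : Even α => Ripplet.analyticOrderAt_hat_phi_zero_even hn μ hα h
  refine ⟨?_, hodd, heven⟩
  rcases Int.even_or_odd α with h | h
  · rw [heven h]
    exact_mod_cast (by omega : 1 ≤ n - 1)
  · exact (hodd h).ge
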